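/- Let $c,d\in\mathbb N$, let $H,Q_1,\dots,Q_c$ be $d\times d$ Hermitian matrices and let $q\in\mathbb R^c$. Let $\mathcal M_d$ be the set of Hermitian $d\times d$ matrices $M$ with $0\le M\le I$, and assume that some $M\in\mathcal M_d$ satisfies $\operatorname{Tr}[Q_iM]=q_i$ for all $i\in\{1,\dots,c\}$. For $T>0$ define $$E:=\min_{M\in\mathcal M_d}\{\operatorname{Tr}[HM]:\operatorname{Tr}[Q_iM]=q_i\ \forall i\},\qquad F_T:=\min_{M\in\mathcal M_d}\{\operatorname{Tr}[HM]-T\,S_{\mathrm{FD}}(M):\operatorname{Tr}[Q_iM]=q_i\ \forall i\},$$ where $S_{\mathrm{FD}}(M):=S(M)+S(I-M)$ and $S(M):=-\operatorname{Tr}[M\ln M]$. For $\mu\in\mathbb R^c$ write $\mu\cdot q:=\sum_i\mu_iq_i$ and $\mu\cdot Q:=\sum_i\mu_iQ_i$, and define the dual objective functions $$f(\mu):=\mu\cdot q-\operatorname{Tr}[(H-\mu\cdot Q)_-],\qquad f_T(\mu):=\mu\cdot q-T\operatorname{Tr}\!\left[\ln\!\left(e^{-\frac1T(H-\mu\cdot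 Q)}+I\right)\right],$$ where $A_-$ is the (positive semidefinite) negative part of a Hermitian matrix $A$. Fix $T>0$. Let $\mathbb M\subseteq\mathbb R^c$ contain a maximizer $\mu^\star$ of $f$ over $\mathbb R^c$ and a maximizer $\mu_T^\star$ of $f_T$ over $\mathbb R^c$. Let $d_0$ be an integer with $0\le d_0\le d$ and let $\Delta>0$ be such that, for every $\mu\in\mathbb M$, $\dim\ker(H-\mu\cdot Q)\le d_0$ and every nonzero eigenvalue $\lambda$ of $H-\mu\cdot Q$ satisfies $|\lambda|\ge\Delta$. Then $$F_T\ \ge\ E-T\left(d_0\ln 2+(d-d_0)\,e^{-\Delta/T}\right).$$ Consequently, if $d_0\ge1$, then for every $\varepsilon>0$ such that $$T\le\min\left\{\frac{\varepsilon}{2d_0\ln2},\ \frac{\Delta}{\ln\!\left(\frac1{\ln2}\cdot\frac{d-d_0}{d_0}\right)}\right\},$$ where the second term of the minimum is read as $+\infty$ if $\frac1{\ln2}\cdot\frac{d-d_0}{d_0}\le1$, one has $$E\ \ge\ F_T\ \ge\ E-\varepsilon.$$ -/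

import Mathlib

open scoped ComplexOrder

namespace FermiDirac

/-- The measurement operators on `ℂ^d`: Hermitian matrices `M` with `0 ≤ M ≤ I`. -/
def measurementOperators (d : ℕ) : Set (Matrix (Fin d) (Fin d) ℂ) :=
  {M | M.PosSemidef ∧ (1 - M).PosSemidef}

/-- The measurement operators `M` that satisfy the constraints `Tr[Q_i M] = q_i` for all `i`. -/
def feasible {c d : ℕ} (Q : Fin c → Matrix (Fin d) (Fin d) ℂ) (q : Fin c → ℝ) :
    Set (Matrix (Fin d) (Fin d) ℂ) :=
  {M | M ∈ measurementOperators d ∧ ∀ i, (Q i * M).trace = (q i : ℂ)}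

/-- The von Neumann entropy `S(M) = -Tr[M ln M]`. The logarithm is taken through the functional
calculus; `Real.log 0 = 0` yields the usual convention `0 ln 0 = 0`. -/
noncomputable def vonNeumannEntropy {d : ℕ} (M : Matrix (Fin d) (Fin d) ℂ) : ℝ :=
  -(M * cfc Real.log M).trace.re

/-- The Fermi-Dirac entropy `S_FD(M) = S(M) + S(I - M)`. -/
noncomputable def fermiDiracEntropy {d : ℕ} (M : Matrix (Fin d) (Fin d) ℂ) : ℝ :=
  vonNeumannEntropy M + vonNeumannEntropy (1 - M)

/-- The optimal energy `E(𝒬, q)`: the minimum of `Tr[H M]` over the feasible measurement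
operators (the infimum is attained, see `isLeast_optimalEnergy` below, as soon as
there is a feasible point). -/
noncomputable def optimalEnergy {c d : ℕ} (H : Matrix (Fin d) (Fin d) ℂ)
    (Q : Fin c → Matrix (Fin d) (Fin d) ℂ) (q : Fin c → ℝ) : ℝ :=
  sInf ((fun M => (H * M).trace.re) '' feasible Q q)

/-- The optimal free energy `F_T(𝒬, q)`: the minimum of `Tr[H M] - T S_FD(M)` over the feasible
measurement operators (attained as well, see `isLeast_optimalFreeEnergy`). -/
noncomputable def optimalFreeEnergy {c d : ℕ} (T : ℝ) (H : Matrix (Fin d) (Fin d) ℂ)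
    (Q : Fin c → Matrix (Fin d) (Fin d) ℂ) (q : Fin c → ℝ) : ℝ :=
  sInf ((fun M => (H * M).trace.re - T * fermiDiracEntropy M) '' feasible Q q)

/-- The grand Hamiltonian `H - μ · Q`, where `μ · Q = ∑ i, μ i Q_i`. -/
noncomputable def shifted {c d : ℕ} (H : Matrix (Fin d) (Fin d) ℂ)
    (Q : Fin c → Matrix (Fin d) (Fin d) ℂ) (μ : Fin c → ℝ) : Matrix (Fin d) (Fin d) ℂ :=
  H - ∑ i, μ i • Q i

/-- The dual objective function `f(μ) = μ · q - Tr[(H - μ · Q)₋]`, with `A₋` the (positive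
semidefinite) negative part of `A`. -/
noncomputable def dualObjective {c d : ℕ} (H : Matrix (Fin d) (Fin d) ℂ)
    (Q : Fin c → Matrix (Fin d) (Fin d) ℂ) (q : Fin c → ℝ) (μ : Fin c → ℝ) : ℝ :=
  (∑ i, μ i * q i) - (cfc (fun x : ℝ => max (-x) 0) (shifted H Q μ)).trace.re

/-- The dual objective function at temperature `T`:
`f_T(μ) = μ · q - T Tr[ln(exp(-(H - μ · Q) / T) + I)]`. -/
noncomputable def dualFreeObjective {c d : ℕ} (T : ℝ) (H : Matrix (Fin d) (Fin d) ℂ)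
    (Q : Fin c → Matrix (Fin d) (Fin d) ℂ) (q : Fin c → ℝ) (μ : Fin c → ℝ) : ℝ :=
  (∑ i, μ i * q i) -
    T * (cfc Real.log (NormedSpace.exp (-(1 / T) • shifted H Q μ) + 1)).trace.re

theorem vonNeumannEntropy_eq {d : ℕ} {M : Matrix (Fin d) (Fin d) ℂ} (hM : M.IsHermitian) :
    vonNeumannEntropy M = (cfc Real.negMulLog M).trace.re := by
  have h : cfc Real.negMulLog M = -(M * cfc Real.log M) := by
    have h1 : M * cfc Real.log M = cfc (fun x : ℝ => x * Real.log x) M := by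
      rw [cfc_mul (fun x : ℝ => x) Real.log M (by fun_prop)
        (Matrix.finite_real_spectrum.continuousOn _), cfc_id' ℝ M hM.isSelfAdjoint]
    rw [h1, ← cfc_neg]
    congr 1
    ext x
    simp [Real.negMulLog]
  rw [h, vonNeumannEntropy]
  simp

/- Both minima are attained as soon as there is a feasible measurement operator. -/

section attained

open scoped Matrix.Norms.L2Operator MatrixOrder

theorem isCompact_measurementOperators (d : ℕ) : IsCompact (measurementOperators d) := by
  have h : measurementOperators d = Set.Icc (0 : Matrix (Fin d) (Fin d) ℂ) 1 := by
    ext M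
    simp [measurementOperators, Matrix.le_iff]
  rw [h]
  refine Metric.isCompact_of_isClosed_isBounded isClosed_Icc ?_
  refine (Metric.isBounded_closedBall (x := (0 : Matrix (Fin d) (Fin d) ℂ))
    (r := ‖(1 : Matrix (Fin d) (Fin d) ℂ)‖)).subset ?_
  intro M hM
  simpa using CStarAlgebra.norm_le_norm_of_nonneg_of_le hM.1 hM.2

theorem isCompact_feasible {c d : ℕ} (Q : Fin c → Matrix (Fin d) (Fin d) ℂ) (q : Fin c → ℝ) :
    IsCompact (feasible Q q) := by
  refine (isCompact_measurementOperators d).inter_right (t := {M | ∀ i, (Q i * M).trace = (q i : ℂ)}) ?_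
  simp only [Set.ofPred_forall]
  exact isClosed_iInter fun i => isClosed_eq (by fun_prop) continuous_const

theorem continuousOn_fermiDiracEntropy (d : ℕ) :
    ContinuousOn (fermiDiracEntropy (d := d)) (measurementOperators d) := by
  have key : ContinuousOn (fun M : Matrix (Fin d) (Fin d) ℂ => (cfc Real.negMulLog M).trace.re)
      (measurementOperators d) := by
    have h := continuousOn_cfc (A := Matrix (Fin d) (Fin d) ℂ) (p := IsSelfAdjoint)
      (isCompact_Icc (a := (0 : ℝ)) (b := 1)) Real.negMulLog Real.continuous_negMulLog.continuousOn
    have h2 : ContinuousOn (fun M : Matrix (Fin d) (Fin d) ℂ => cfc Real.negMulLog M)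
        (measurementOperators d) := by
      refine h.mono fun M hM => ⟨hM.1.1, ?_⟩
      intro x hx
      have h1 : (algebraMap ℝ (Matrix (Fin d) (Fin d) ℂ) 0) ≤ M := by simpa using hM.1.nonneg
      have h3 : M ≤ (algebraMap ℝ (Matrix (Fin d) (Fin d) ℂ) 1) := by
        simpa [Matrix.le_iff] using hM.2
      exact ⟨(algebraMap_le_iff_le_spectrum (ha := hM.1.1)).1 h1 x hx,
        (le_algebraMap_iff_spectrum_le (ha := hM.1.1)).1 h3 x hx⟩
    have h4 : Continuous fun M : Matrix (Fin d) (Fin d) ℂ => M.trace.re := by fun_prop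
    exact h4.comp_continuousOn h2
  have key2 : ContinuousOn
      (fun M : Matrix (Fin d) (Fin d) ℂ => (cfc Real.negMulLog (1 - M)).trace.re)
      (measurementOperators d) := by
    refine key.comp (f := fun M : Matrix (Fin d) (Fin d) ℂ => 1 - M) (by fun_prop) fun M hM => ?_
    exact ⟨hM.2, by simpa using hM.1⟩
  refine (key.add key2).congr fun M hM => ?_
  simp only [fermiDiracEntropy, Pi.add_apply]
  rw [vonNeumannEntropy_eq hM.1.1, vonNeumannEntropy_eq hM.2.1]

theorem isLeast_optimalEnergy {c d : ℕ} (H : Matrix (Fin d) (Fin d) ℂ)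
    (Q : Fin c → Matrix (Fin d) (Fin d) ℂ) (q : Fin c → ℝ) (h : (feasible Q q).Nonempty) :
    IsLeast ((fun M => (H * M).trace.re) '' feasible Q q) (optimalEnergy H Q q) :=
  ((isCompact_feasible Q q).image_of_continuousOn (by fun_prop)).isLeast_sInf (h.image _)

theorem isLeast_optimalFreeEnergy {c d : ℕ} (T : ℝ) (H : Matrix (Fin d) (Fin d) ℂ)
    (Q : Fin c → Matrix (Fin d) (Fin d) ℂ) (q : Fin c → ℝ) (h : (feasible Q q).Nonempty) :
    IsLeast ((fun M => (H * M).trace.re - T * fermiDiracEntropy M) '' feasible Q q)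
      (optimalFreeEnergy T H Q q) := by
  refine ((isCompact_feasible Q q).image_of_continuousOn ?_).isLeast_sInf (h.image _)
  have h1 := (continuousOn_fermiDiracEntropy d).mono (fun M (hM : M ∈ feasible Q q) => hM.1)
  exact ContinuousOn.sub (by fun_prop) (continuousOn_const.mul h1)

end attained

end FermiDirac

open scoped ComplexOrder

/-! The proof is the chain `F_T ≥ f_T(μ) ≥ f(μ) - correction ≥ E - correction` at a maximizer `μ` of
`f`. The first inequality is weak duality: on feasible `M` the shift by `μ · Q` costs exactly `μ ·
q`, and `gibbs_variational` bounds the shifted free energy below. The last is strong duality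
(`exists_lt_dualObjective`), obtained by separating convex sets. In between, the identity `ln(e^{-x}
+ 1) = max(-x, 0) + ln(1 + e^{-|x|})` gives `f(μ) - f_T(μ) = T ∑ ln(1 + e^{-|λ|/T})` over the
eigenvalues `λ` of `H - μ · Q`. A zero eigenvalue contributes `ln 2`, any other at most `e^{-Δ/T}`.
The upper bound `F_T ≤ E` is nonnegativity of the entropy. -/

namespace FermiDirac

/-! ### Traces of products in two eigenbases -/

section Spectral

variable {n : Type*} [Fintype n] [DecidableEq n]

/-- The squared overlaps of the eigenvectors of two Hermitian matrices. -/
noncomputable def overlap {A M : Matrix n n ℂ} (hA : A.IsHermitian) (hM : M.IsHermitian)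
    (i j : n) : ℝ :=
  Complex.normSq ((star (hA.eigenvectorUnitary : Matrix n n ℂ) *
    (hM.eigenvectorUnitary : Matrix n n ℂ)) i j)

theorem overlap_nonneg {A M : Matrix n n ℂ} (hA : A.IsHermitian) (hM : M.IsHermitian) (i j : n) :
    0 ≤ overlap hA hM i j :=
  Complex.normSq_nonneg _

theorem trace_diagonal_mul_mul_diagonal_mul_star (W : Matrix n n ℂ) (a b : n → ℝ) :
    (Matrix.diagonal (fun i => (a i : ℂ)) * W * Matrix.diagonal (fun i => (b i : ℂ)) *
      star W).trace = ((∑ i, ∑ j, Complex.normSq (W i j) * (a i * b j) : ℝ) : ℂ) := by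
  simp only [Matrix.trace, Matrix.diag_apply, Matrix.mul_apply (N := star W),
    Matrix.mul_diagonal, Matrix.diagonal_mul, Matrix.star_apply]
  push_cast
  refine Finset.sum_congr rfl fun i _ => Finset.sum_congr rfl fun j _ => ?_
  rw [Complex.normSq_eq_conj_mul_self, Complex.star_def]
  ring

theorem cfc_eq_conj {A : Matrix n n ℂ} (hA : A.IsHermitian) (g : ℝ → ℝ) :
    cfc g A = (hA.eigenvectorUnitary : Matrix n n ℂ) *
      Matrix.diagonal (fun i => ((g (hA.eigenvalues i) : ℝ) : ℂ)) *
      star (hA.eigenvectorUnitary : Matrix n n ℂ) := by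
  rw [hA.cfc_eq, Matrix.IsHermitian.cfc, Unitary.conjStarAlgAut_apply]
  rfl

theorem trace_cfc {A : Matrix n n ℂ} (hA : A.IsHermitian) (g : ℝ → ℝ) :
    (cfc g A).trace.re = ∑ i, g (hA.eigenvalues i) := by
  rw [cfc_eq_conj hA, Matrix.trace_mul_cycle, Unitary.coe_star_mul_self, one_mul,
    Matrix.trace_diagonal, ← Complex.ofReal_sum, Complex.ofReal_re]

/-- Since the overlaps are nonnegative weights, trace inequalities between noncommuting `A` and `M`
reduce to scalar inequalities between their eigenvalues. -/
theorem trace_cfc_mul_cfc {A M : Matrix n n ℂ} (hA : A.IsHermitian) (hM : M.IsHermitian)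
    (g h : ℝ → ℝ) :
    (cfc g A * cfc h M).trace.re =
      ∑ i, ∑ j, overlap hA hM i j * (g (hA.eigenvalues i) * h (hM.eigenvalues j)) := by
  rw [cfc_eq_conj hA, cfc_eq_conj hM]
  have key := trace_diagonal_mul_mul_diagonal_mul_star
    (star (hA.eigenvectorUnitary : Matrix n n ℂ) * (hM.eigenvectorUnitary : Matrix n n ℂ))
    (fun i => g (hA.eigenvalues i)) (fun j => h (hM.eigenvalues j))
  rw [star_mul, star_star] at key
  rw [mul_assoc, mul_assoc, Matrix.trace_mul_comm]
  simp only [mul_assoc] at key ⊢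
  rw [key, Complex.ofReal_re]
  rfl

theorem eigenvalues_mem_Icc {M : Matrix n n ℂ} (hM : M.PosSemidef) (hM' : (1 - M).PosSemidef)
    (j : n) : hM.1.eigenvalues j ∈ Set.Icc (0 : ℝ) 1 := by
  refine ⟨hM.eigenvalues_nonneg j, ?_⟩
  open scoped MatrixOrder Matrix.Norms.L2Operator in
  have h : M ≤ algebraMap ℝ (Matrix n n ℂ) 1 := by simpa [Matrix.le_iff] using hM'
  exact (le_algebraMap_iff_spectrum_le (ha := hM.1)).1 h _ (hM.1.eigenvalues_mem_spectrum_real j)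

end Spectral

/-! ### Fermi-Dirac entropy as a sum of binary entropies -/

theorem fermiDiracEntropy_eq {d : ℕ} {M : Matrix (Fin d) (Fin d) ℂ} (hM : M.IsHermitian) :
    fermiDiracEntropy M = (cfc Real.binEntropy M).trace.re := by
  have hM' : (1 - M).IsHermitian := Matrix.isHermitian_one.sub hM
  have h1 : (1 - M) = cfc (fun x : ℝ => 1 - x) M := by
    rw [cfc_sub (fun _ : ℝ => 1) (fun x => x) M, cfc_const_one ℝ M, cfc_id' ℝ M hM.isSelfAdjoint]
  have h2 : cfc Real.negMulLog (1 - M) = cfc (fun x => Real.negMulLog (1 - x)) M := by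
    rw [h1, ← cfc_comp' Real.negMulLog (fun x : ℝ => 1 - x) M
      (Real.continuous_negMulLog.continuousOn)]
  rw [fermiDiracEntropy, vonNeumannEntropy_eq hM, vonNeumannEntropy_eq hM', h2, trace_cfc hM,
    trace_cfc hM, trace_cfc hM, ← Finset.sum_add_distrib]
  simp [Real.binEntropy_eq_negMulLog_add_negMulLog_one_sub]

theorem fermiDiracEntropy_nonneg {d : ℕ} {M : Matrix (Fin d) (Fin d) ℂ}
    (hM : M ∈ measurementOperators d) : 0 ≤ fermiDiracEntropy M := by
  rw [fermiDiracEntropy_eq hM.1.1, trace_cfc hM.1.1]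
  refine Finset.sum_nonneg fun i _ => ?_
  have h := eigenvalues_mem_Icc hM.1 hM.2 i
  exact Real.binEntropy_nonneg h.1 h.2

/-- The Gibbs variational inequality for a single fermionic mode. -/
theorem binEntropy_le {m : ℝ} (hm : m ∈ Set.Icc (0 : ℝ) 1) (a : ℝ) :
    Real.binEntropy m ≤ a * m + Real.log (Real.exp (-a) + 1) := by
  have hpos : 0 < Real.exp (-a) + 1 := by positivity
  -- One term of the nonnegativity of relative entropy: `log y ≤ y - 1` at `y = p / x`.
  have key : ∀ x p : ℝ, 0 ≤ x → 0 < p → Real.negMulLog x + x * Real.log p ≤ p - x := by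
    intro x p hx hp
    rcases hx.eq_or_lt with rfl | hx
    · simpa using hp.le
    · have h := Real.log_le_sub_one_of_pos (div_pos hp hx)
      rw [Real.log_div hp.ne' hx.ne'] at h
      have h' := mul_le_mul_of_nonneg_left h hx.le
      have : x * (p / x - 1) = p - x := by field_simp
      rw [Real.negMulLog]
      linarith
  -- The comparison distribution is the Fermi-Dirac occupation, the equality case. Both
  -- distributions have mass one, so the terms `p - x` cancel in the sum.
  have h1 := key m (Real.exp (-a) / (Real.exp (-a) + 1)) hm.1 (by positivity)
  have h2 := key (1 - m) (1 / (Real.exp (-a) + 1)) (by linarith [hm.2]) (by positivity)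
  have h3 : Real.exp (-a) / (Real.exp (-a) + 1) + 1 / (Real.exp (-a) + 1) = 1 := by field_simp
  rw [Real.log_div (Real.exp_ne_zero _) hpos.ne', Real.log_exp] at h1
  rw [Real.log_div one_ne_zero hpos.ne', Real.log_one] at h2
  rw [Real.binEntropy_eq_negMulLog_add_negMulLog_one_sub]
  linarith

/-! ### Gibbs bound and spectral estimates for a fixed Hermitian matrix -/

section

variable {d : ℕ} {A M : Matrix (Fin d) (Fin d) ℂ}

theorem gibbs_variational (hA : A.IsHermitian) (hM : M ∈ measurementOperators d) {T : ℝ}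
    (hT : 0 < T) :
    -(T * ∑ i, Real.log (Real.exp (-(hA.eigenvalues i / T)) + 1)) ≤
      (A * M).trace.re - T * fermiDiracEntropy M := by
  have hM1 := hM.1.1
  have e1 : (A * M).trace.re = ∑ i, ∑ j, overlap hA hM1 i j *
      (hA.eigenvalues i * hM1.eigenvalues j) := by
    have := trace_cfc_mul_cfc hA hM1 (fun x => x) (fun x => x)
    rwa [cfc_id' ℝ A hA.isSelfAdjoint, cfc_id' ℝ M hM1.isSelfAdjoint] at this
  -- Taking the constant function `1` for one matrix encodes that the overlaps sum to one along rows
  -- and columns. All three traces thus become double sums with the same weights, comparable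
  -- termwise.
  have e2 : fermiDiracEntropy M = ∑ i, ∑ j, overlap hA hM1 i j *
      Real.binEntropy (hM1.eigenvalues j) := by
    have := trace_cfc_mul_cfc hA hM1 (fun _ => 1) Real.binEntropy
    rw [cfc_const_one ℝ A hA.isSelfAdjoint, one_mul, ← fermiDiracEntropy_eq hM1] at this
    simpa using this
  have e3 : ∑ i, Real.log (Real.exp (-(hA.eigenvalues i / T)) + 1) = ∑ i, ∑ j,
      overlap hA hM1 i j * Real.log (Real.exp (-(hA.eigenvalues i / T)) + 1) := by
    have := trace_cfc_mul_cfc hA hM1 (fun x => Real.log (Real.exp (-(x / T)) + 1)) (fun _ => 1)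
    rw [cfc_const_one ℝ M hM1.isSelfAdjoint, mul_one, trace_cfc hA] at this
    simpa using this
  rw [e1, e2, e3, neg_le_iff_add_nonneg', Finset.mul_sum, Finset.mul_sum,
    ← sub_nonneg, sub_zero, ← add_sub_assoc, ← Finset.sum_add_distrib, ← Finset.sum_sub_distrib]
  refine Finset.sum_nonneg fun i _ => ?_
  rw [Finset.mul_sum, Finset.mul_sum, ← Finset.sum_add_distrib, ← Finset.sum_sub_distrib]
  refine Finset.sum_nonneg fun j _ => ?_
  have h := binEntropy_le (eigenvalues_mem_Icc hM.1 hM.2 j) (hA.eigenvalues i / T)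
  have h' := mul_le_mul_of_nonneg_left h hT.le
  have h'' : T * (hA.eigenvalues i / T * hM1.eigenvalues j) =
    hA.eigenvalues i * hM1.eigenvalues j := by field_simp
  rw [mul_add, h''] at h'
  have := mul_nonneg (overlap_nonneg hA hM1 i j) (sub_nonneg.2 h')
  linarith

theorem trace_log_exp_add_one (hA : A.IsHermitian) (T : ℝ) :
    (cfc Real.log (NormedSpace.exp (-(1 / T) • A) + 1)).trace.re =
      ∑ i, Real.log (Real.exp (-(hA.eigenvalues i / T)) + 1) := by
  have h1 : NormedSpace.exp (-(1 / T) • A) = cfc (fun x : ℝ => Real.exp (-(1 / T) * x)) A := by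
    have h0 : (-(1 / T) • A) = cfc (fun x : ℝ => -(1 / T) * x) A := by
      rw [cfc_const_mul _ (fun x : ℝ => x) A, cfc_id' ℝ A hA.isSelfAdjoint]
    have h2 : IsSelfAdjoint (-(1 / T) • A) := by rw [h0]; exact cfc_predicate _ A
    open scoped Matrix.Norms.L2Operator in
    have h3 := CFC.real_exp_eq_normedSpace_exp h2
    rw [← h3, h0, ← cfc_comp' Real.exp (fun x : ℝ => -(1 / T) * x) A]
  have h2 : NormedSpace.exp (-(1 / T) • A) + 1 =
      cfc (fun x : ℝ => Real.exp (-(1 / T) * x) + 1) A := by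
    rw [h1, cfc_add A (fun x : ℝ => Real.exp (-(1 / T) * x)) (fun _ => 1),
      cfc_const_one ℝ A hA.isSelfAdjoint]
  rw [h2, ← cfc_comp' Real.log (fun x : ℝ => Real.exp (-(1 / T) * x) + 1) A ?_, trace_cfc hA]
  · refine Finset.sum_congr rfl fun i _ => ?_
    congr 3
    ring
  · exact ((A.finite_real_spectrum).image _).continuousOn _

/-- Rank-nullity, with the rank counted by the nonzero eigenvalues. -/
theorem finrank_ker_eq_card (hA : A.IsHermitian) :
    Module.finrank ℂ (LinearMap.ker (Matrix.toLin' A)) =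
      (Finset.univ.filter fun i => hA.eigenvalues i = 0).card := by
  have h1 := (Matrix.toLin' A).finrank_range_add_finrank_ker
  have h2 : Module.finrank ℂ (LinearMap.range (Matrix.toLin' A)) = A.rank := rfl
  rw [h2, hA.rank_eq_card_non_zero_eigs, Fintype.card_subtype, Module.finrank_fin_fun] at h1
  have h3 := Finset.card_filter_add_card_filter_not (s := Finset.univ)
    (fun i => hA.eigenvalues i = 0)
  simp only [Finset.card_univ, Fintype.card_fin] at h3
  simp only [ne_eq] at h1
  omega

theorem hasEigenvalue_eigenvalues (hA : A.IsHermitian) (i : Fin d) :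
    Module.End.HasEigenvalue (Matrix.toLin' A) (hA.eigenvalues i : ℂ) := by
  rw [Module.End.hasEigenvalue_iff_mem_spectrum, Matrix.spectrum_toLin',
    hA.spectrum_eq_image_range]
  exact ⟨_, ⟨i, rfl⟩, rfl⟩

/-- Factor out the larger of `e^{-x}` and `1`. The first summand is the zero-temperature term of
`f`, the second the thermal correction. -/
theorem log_exp_neg_add_one (x : ℝ) :
    Real.log (Real.exp (-x) + 1) = max (-x) 0 + Real.log (1 + Real.exp (-|x|)) := by
  rcases le_total 0 x with h | h
  · rw [abs_of_nonneg h, max_eq_right (by linarith), zero_add, add_comm]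
  · rw [abs_of_nonpos h, max_eq_left (by linarith), neg_neg]
    nth_rewrite 2 [← Real.log_exp (-x)]
    rw [← Real.log_mul (by positivity) (by positivity), mul_add, ← Real.exp_add]
    simp

/-- The free energy correction of a spectrum with at most `d₀` zeros and gap `Δ`. -/
theorem sum_log_one_add_exp_le {a : Fin d → ℝ} {d₀ : ℕ} (hd₀ : d₀ ≤ d)
    (hcard : (Finset.univ.filter fun i => a i = 0).card ≤ d₀) {Δ T : ℝ} (hΔ : 0 < Δ) (hT : 0 < T)
    (hgap : ∀ i, a i ≠ 0 → Δ ≤ |a i|) :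
    ∑ i, Real.log (1 + Real.exp (-|a i / T|)) ≤
      d₀ * Real.log 2 + ((d : ℝ) - d₀) * Real.exp (-(Δ / T)) := by
  set L := Real.log (1 + Real.exp (-(Δ / T))) with hL
  have hL2 : L ≤ Real.log 2 := by
    refine Real.log_le_log (by positivity) ?_
    have : Real.exp (-(Δ / T)) ≤ 1 := Real.exp_le_one_iff.2 (by have := div_pos hΔ hT; linarith)
    linarith
  have hLe : L ≤ Real.exp (-(Δ / T)) := by
    have := Real.log_le_sub_one_of_pos (show 0 < 1 + Real.exp (-(Δ / T)) by positivity)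
    linarith
  -- Every index is charged `L`, and each zero a surcharge `log 2 - L ≥ 0`. The total is therefore
  -- monotone in the number of zeros, which may be replaced by `d₀`.
  have h1 : ∀ i, Real.log (1 + Real.exp (-|a i / T|)) ≤
      L + if a i = 0 then Real.log 2 - L else 0 := by
    intro i
    split_ifs with h
    · rw [h]; norm_num
    · rw [add_zero]
      refine Real.log_le_log (by positivity) ?_
      rw [abs_div, abs_of_pos hT]
      gcongr
      exact hgap i h
  have h2 := Finset.sum_le_sum fun i (_ : i ∈ Finset.univ) => h1 i
  rw [Finset.sum_add_distrib, ← Finset.sum_filter, Finset.sum_const, Finset.sum_const,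
    Finset.card_univ, Fintype.card_fin, nsmul_eq_mul, nsmul_eq_mul] at h2
  have hc : ((Finset.univ.filter fun i => a i = 0).card : ℝ) ≤ d₀ := by exact_mod_cast hcard
  have hd : (d₀ : ℝ) ≤ d := by exact_mod_cast hd₀
  have h3 := mul_le_mul_of_nonneg_right hc (sub_nonneg.2 hL2)
  have h4 := mul_le_mul_of_nonneg_left hLe (sub_nonneg.2 hd)
  linarith

/-- The witness is the spectral projection of `A` onto its negative eigenvalues. -/
theorem exists_trace_mul_eq_neg_trace_negPart (hA : A.IsHermitian) :
    ∃ M ∈ measurementOperators d,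
      (A * M).trace.re = -(cfc (fun x : ℝ => max (-x) 0) A).trace.re := by
  have hcont : ∀ g : ℝ → ℝ, ContinuousOn g (spectrum ℝ A) := fun g =>
    Matrix.finite_real_spectrum.continuousOn g
  have hpos : ∀ g : ℝ → ℝ, (∀ x, 0 ≤ g x) → (cfc g A).PosSemidef := by
    intro g hg
    open scoped MatrixOrder Matrix.Norms.L2Operator in
    exact Matrix.nonneg_iff_posSemidef.1 (cfc_nonneg fun x _ => hg x)
  refine ⟨cfc (fun x : ℝ => if x < 0 then 1 else 0) A, ⟨hpos _ fun x => ?_, ?_⟩, ?_⟩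
  · split_ifs <;> norm_num
  · have h : 1 - cfc (fun x : ℝ => if x < 0 then 1 else 0) A =
        cfc (fun x : ℝ => 1 - if x < 0 then 1 else 0) A := by
      rw [cfc_sub (fun _ : ℝ => 1) _ A (hcont _) (hcont _), cfc_const_one ℝ A hA.isSelfAdjoint]
    rw [h]
    refine hpos _ fun x => ?_
    split_ifs <;> norm_num
  · have h : A * cfc (fun x : ℝ => if x < 0 then 1 else 0) A =
        cfc (fun x : ℝ => x * if x < 0 then 1 else 0) A := by
      rw [cfc_mul (fun x : ℝ => x) _ A (hcont _) (hcont _), cfc_id' ℝ A hA.isSelfAdjoint]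
    rw [h, trace_cfc hA, trace_cfc hA, ← Finset.sum_neg_distrib]
    refine Finset.sum_congr rfl fun i _ => ?_
    split_ifs with hi
    · rw [max_eq_left (by linarith)]; ring
    · rw [max_eq_right (by linarith)]; ring

end

/-! ### Weak and strong duality -/

section Duality

variable {c d : ℕ} {H : Matrix (Fin d) (Fin d) ℂ} {Q : Fin c → Matrix (Fin d) (Fin d) ℂ}
  {q : Fin c → ℝ}

theorem isHermitian_shifted (hH : H.IsHermitian) (hQ : ∀ i, (Q i).IsHermitian) (μ : Fin c → ℝ) :
    (shifted H Q μ).IsHermitian := by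
  refine hH.sub ?_
  have : IsSelfAdjoint (∑ i, μ i • Q i) :=
    isSelfAdjoint_sum _ fun i _ => (IsSelfAdjoint.all (μ i)).smul (hQ i).isSelfAdjoint
  exact this

theorem trace_shifted_mul (H : Matrix (Fin d) (Fin d) ℂ) (Q : Fin c → Matrix (Fin d) (Fin d) ℂ)
    (μ : Fin c → ℝ) (M : Matrix (Fin d) (Fin d) ℂ) :
    (shifted H Q μ * M).trace.re = (H * M).trace.re - ∑ i, μ i * (Q i * M).trace.re := by
  simp [shifted, sub_mul, Finset.sum_mul, Matrix.trace_sum]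

theorem dualFreeObjective_le_optimalFreeEnergy (hH : H.IsHermitian) (hQ : ∀ i, (Q i).IsHermitian)
    (hfeas : (feasible Q q).Nonempty) {T : ℝ} (hT : 0 < T) (μ : Fin c → ℝ) :
    dualFreeObjective T H Q q μ ≤ optimalFreeEnergy T H Q q := by
  obtain ⟨M, hM, hMF⟩ := (isLeast_optimalFreeEnergy T H Q q hfeas).1
  have hA := isHermitian_shifted hH hQ μ
  have h := gibbs_variational hA hM.1 hT
  rw [trace_shifted_mul] at h
  simp only [hM.2, Complex.ofReal_re] at h
  rw [← hMF, dualFreeObjective, trace_log_exp_add_one hA]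
  dsimp only
  linarith

theorem optimalFreeEnergy_le_optimalEnergy (hfeas : (feasible Q q).Nonempty) {T : ℝ}
    (hT : 0 ≤ T) : optimalFreeEnergy T H Q q ≤ optimalEnergy H Q q := by
  obtain ⟨M, hM, hME⟩ := (isLeast_optimalEnergy H Q q hfeas).1
  refine ((isLeast_optimalFreeEnergy T H Q q hfeas).2 ⟨M, hM, rfl⟩).trans ?_
  rw [← hME]
  have := mul_nonneg hT (fermiDiracEntropy_nonneg hM.1)
  dsimp only
  linarith

theorem dualObjective_sub_le_dualFreeObjective {μ : Fin c → ℝ}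
    (hA : (shifted H Q μ).IsHermitian) {d₀ : ℕ} (hd₀ : d₀ ≤ d)
    (hker : Module.finrank ℂ (LinearMap.ker (Matrix.toLin' (shifted H Q μ))) ≤ d₀)
    {Δ T : ℝ} (hΔ : 0 < Δ) (hT : 0 < T)
    (hgap : ∀ z : ℂ, Module.End.HasEigenvalue (Matrix.toLin' (shifted H Q μ)) z → z ≠ 0 →
      Δ ≤ ‖z‖) :
    dualObjective H Q q μ - T * (d₀ * Real.log 2 + ((d : ℝ) - d₀) * Real.exp (-(Δ / T))) ≤
      dualFreeObjective T H Q q μ := by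
  have h := sum_log_one_add_exp_le hd₀ ((finrank_ker_eq_card hA).symm.trans_le hker) hΔ hT
    fun i hi => by
      simpa using hgap _ (hasEigenvalue_eigenvalues hA i) (by exact_mod_cast hi)
  have h' := mul_le_mul_of_nonneg_left h hT.le
  have h2 : T * ∑ i, Real.log (Real.exp (-(hA.eigenvalues i / T)) + 1) =
      ∑ i, max (-hA.eigenvalues i) 0 +
        T * ∑ i, Real.log (1 + Real.exp (-|hA.eigenvalues i / T|)) := by
    rw [Finset.mul_sum, Finset.mul_sum, ← Finset.sum_add_distrib]
    refine Finset.sum_congr rfl fun i _ => ?_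
    rw [log_exp_neg_add_one, mul_add, mul_max_of_nonneg _ _ hT.le, mul_zero, mul_neg,
      mul_div_cancel₀ _ hT.ne']
  rw [dualObjective, dualFreeObjective, trace_log_exp_add_one hA, trace_cfc hA, h2]
  linarith

theorem convex_measurementOperators (d : ℕ) : Convex ℝ (measurementOperators d) := by
  intro M hM N hN a b ha hb hab
  refine ⟨(hM.1.smul ha).add (hN.1.smul hb), ?_⟩
  have : 1 - (a • M + b • N) = a • (1 - M) + b • (1 - N) := by
    rw [smul_sub, smul_sub, sub_add_sub_comm, ← add_smul, hab, one_smul]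
  rw [this]
  exact (hM.2.smul ha).add (hN.2.smul hb)

/-- Strong duality, by separating `(q, r)` from the compact convex set of attainable values. -/
theorem exists_lt_dualObjective (hH : H.IsHermitian) (hQ : ∀ i, (Q i).IsHermitian)
    (hfeas : (feasible Q q).Nonempty) {r : ℝ} (hr : r < optimalEnergy H Q q) :
    ∃ μ, r < dualObjective H Q q μ := by
  let Φ : Matrix (Fin d) (Fin d) ℂ →ₗ[ℝ] (Fin c → ℝ) × ℝ :=
    LinearMap.prod
      (LinearMap.pi fun i => Complex.reLm ∘ₗ
        (Matrix.traceLinearMap (Fin d) ℝ ℂ) ∘ₗ LinearMap.mulLeft ℝ (Q i))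
      (Complex.reLm ∘ₗ (Matrix.traceLinearMap (Fin d) ℝ ℂ) ∘ₗ LinearMap.mulLeft ℝ H)
  have hΦ : ∀ M, Φ M = (fun i => (Q i * M).trace.re, (H * M).trace.re) := fun M => rfl
  have hΦc : Continuous Φ := by
    have : (Φ : Matrix (Fin d) (Fin d) ℂ → (Fin c → ℝ) × ℝ) =
      fun M => (fun i => (Q i * M).trace.re, (H * M).trace.re) := funext hΦ
    rw [this]
    fun_prop
  -- The constraints are complex equations, but `Φ` records only real parts; nothing is lost, as the
  -- trace of a product of two Hermitian matrices is real.
  have himag : ∀ (i) (M), M ∈ measurementOperators d →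
      (Q i * M).trace = ((Q i * M).trace.re : ℂ) := by
    intro i M hM
    refine (Complex.conj_eq_iff_re.1 ?_).symm
    rw [← Complex.star_def, ← Matrix.trace_conjTranspose, Matrix.conjTranspose_mul,
      (hQ i).eq, hM.1.1.eq, Matrix.trace_mul_comm]
  have hnot : (q, r) ∉ Φ '' measurementOperators d := by
    rintro ⟨M, hM, hMq⟩
    rw [hΦ, Prod.mk.injEq] at hMq
    have hMf : M ∈ feasible Q q := ⟨hM, fun i => by rw [himag i M hM, ← hMq.1]⟩
    have := (isLeast_optimalEnergy H Q q hfeas).2 ⟨M, hMf, rfl⟩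
    dsimp only at this
    linarith [hMq.2]
  obtain ⟨φ, u, hu1, hu2⟩ := geometric_hahn_banach_point_closed
    ((convex_measurementOperators d).linear_image Φ)
    ((isCompact_measurementOperators d).image hΦc).isClosed hnot
  set s := φ (0, 1) with hs
  set ν : Fin c → ℝ := fun i => φ (Pi.single i 1, 0) with hν
  have hφ : ∀ (x : Fin c → ℝ) (t : ℝ), φ (x, t) = ∑ i, x i * ν i + t * s := by
    intro x t
    have e : (x, t) = ∑ i, x i • ((Pi.single i 1, 0) : (Fin c → ℝ) × ℝ) + t • (0, 1) := by
      ext k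
      · simp [Prod.fst_sum, Finset.sum_apply, Pi.single_apply]
      · simp [Prod.snd_sum]
    rw [e, map_add, map_sum]
    simp only [map_smul, smul_eq_mul, hν, hs]
  -- The separating hyperplane is not vertical: a minimizer maps to `(q, E)`, so separation from
  -- `(q, r)` gives `r * s < E * s` with `r < E`.
  have hs0 : 0 < s := by
    obtain ⟨M, hM, hME⟩ := (isLeast_optimalEnergy H Q q hfeas).1
    have h := hu1.trans (hu2 _ ⟨M, hM.1, rfl⟩)
    dsimp only at hME
    rw [hΦ, hφ, hφ, hME] at h
    simp only [hM.2, Complex.ofReal_re] at h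
    by_contra! hs'
    nlinarith
  -- The multiplier is the normal vector rescaled to have last coordinate `1`, up to sign.
  -- Evaluating the separation at the projection that minimizes the shifted energy turns it into `r
  -- < f(μ)`.
  refine ⟨fun i => -(ν i / s), ?_⟩
  obtain ⟨M, hM, hMA⟩ := exists_trace_mul_eq_neg_trace_negPart
    (isHermitian_shifted hH hQ fun i => -(ν i / s))
  have h := hu1.trans (hu2 _ ⟨M, hM, rfl⟩)
  rw [hΦ, hφ, hφ] at h
  rw [dualObjective, sub_eq_add_neg, ← hMA, trace_shifted_mul]
  have e : ∀ x : Fin c → ℝ, s * ∑ i, -(ν i / s) * x i = -∑ i, x i * ν i := by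
    intro x
    rw [Finset.mul_sum, ← Finset.sum_neg_distrib]
    refine Finset.sum_congr rfl fun i _ => ?_
    field_simp
  refine lt_of_mul_lt_mul_left ?_ hs0.le
  rw [mul_add, mul_sub, e, e]
  linarith

theorem optimalEnergy_le_of_dualObjective_le (hH : H.IsHermitian) (hQ : ∀ i, (Q i).IsHermitian)
    (hfeas : (feasible Q q).Nonempty) {μ : Fin c → ℝ}
    (hμ : ∀ ν, dualObjective H Q q ν ≤ dualObjective H Q q μ) :
    optimalEnergy H Q q ≤ dualObjective H Q q μ := by
  by_contra! h
  obtain ⟨ν, hν⟩ := exists_lt_dualObjective hH hQ hfeas h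
  exact (hν.trans_le (hμ ν)).false

end Duality

/-- The first bound on `T` makes the kernel term at most `ε / 2`; the second makes the gapped term
no larger than the kernel term. -/
theorem temperature_correction_le {d d₀ T Δ ε : ℝ} (hd₀ : 0 < d₀) (hT : 0 < T)
    (hΔ : 0 < Δ) (h1 : T ≤ ε / (2 * d₀ * Real.log 2))
    (h2 : 1 < 1 / Real.log 2 * ((d - d₀) / d₀) →
      T ≤ Δ / Real.log (1 / Real.log 2 * ((d - d₀) / d₀))) :
    T * (d₀ * Real.log 2 + (d - d₀) * Real.exp (-(Δ / T))) ≤ ε := by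
  have hl : 0 < Real.log 2 := Real.log_pos one_lt_two
  rw [le_div_iff₀ (by positivity)] at h1
  have key : (d - d₀) * Real.exp (-(Δ / T)) ≤ d₀ * Real.log 2 := by
    have hr : d - d₀ = 1 / Real.log 2 * ((d - d₀) / d₀) * (d₀ * Real.log 2) := by field_simp
    set r := 1 / Real.log 2 * ((d - d₀) / d₀)
    -- For `r ≤ 1` any positive temperature works because the exponential is at most `1`; this is
    -- the case where the second bound is read as `+∞`.
    have hre : r * Real.exp (-(Δ / T)) ≤ 1 := by
      rcases le_or_gt r 1 with h | h
      · have : Real.exp (-(Δ / T)) ≤ 1 :=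
          Real.exp_le_one_iff.2 (by have := div_pos hΔ hT; linarith)
        exact mul_le_one₀ h (Real.exp_nonneg _) this
      · have h3 := h2 h
        rw [le_div_iff₀ (Real.log_pos h), mul_comm, ← le_div_iff₀ hT,
          Real.log_le_iff_le_exp (by linarith)] at h3
        calc r * Real.exp (-(Δ / T)) ≤ Real.exp (Δ / T) * Real.exp (-(Δ / T)) := by gcongr
          _ = 1 := by rw [← Real.exp_add]; simp
    rw [hr]
    have := mul_le_mul_of_nonneg_right hre (show 0 ≤ d₀ * Real.log 2 by positivity)
    linarith
  have := mul_le_mul_of_nonneg_left key hT.le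
  linarith

end FermiDirac

theorem mainTheorem3 {c d : ℕ} (H : Matrix (Fin d) (Fin d) ℂ)
    (Q : Fin c → Matrix (Fin d) (Fin d) ℂ) (q : Fin c → ℝ)
    (hH : H.IsHermitian) (hQ : ∀ i, (Q i).IsHermitian)
    (hfeas : (FermiDirac.feasible Q q).Nonempty)
    (T : ℝ) (hT : 0 < T)
    (𝕄 : Set (Fin c → ℝ)) (μ μT : Fin c → ℝ) (hμ𝕄 : μ ∈ 𝕄) (hμT𝕄 : μT ∈ 𝕄)
    (hμ : ∀ ν, FermiDirac.dualObjective H Q q ν ≤ FermiDirac.dualObjective H Q q μ)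
    (hμT : ∀ ν, FermiDirac.dualFreeObjective T H Q q ν ≤ FermiDirac.dualFreeObjective T H Q q μT)
    (d₀ : ℕ) (hd₀ : d₀ ≤ d)
    (hker : ∀ ν ∈ 𝕄,
      Module.finrank ℂ (LinearMap.ker (Matrix.toLin' (FermiDirac.shifted H Q ν))) ≤ d₀)
    (Δ : ℝ) (hΔ : 0 < Δ)
    (hgap : ∀ ν ∈ 𝕄, ∀ z : ℂ,
      Module.End.HasEigenvalue (Matrix.toLin' (FermiDirac.shifted H Q ν)) z → z ≠ 0 → Δ ≤ ‖z‖) :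
    FermiDirac.optimalFreeEnergy T H Q q ≥ FermiDirac.optimalEnergy H Q q
        - T * (d₀ * Real.log 2 + ((d : ℝ) - d₀) * Real.exp (-(Δ / T))) ∧
    ∀ ε : ℝ, 0 < ε → 0 < d₀ →
      T ≤ ε / (2 * d₀ * Real.log 2) →
      (1 < 1 / Real.log 2 * (((d : ℝ) - d₀) / d₀) →
        T ≤ Δ / Real.log (1 / Real.log 2 * (((d : ℝ) - d₀) / d₀))) →
      FermiDirac.optimalEnergy H Q q ≥ FermiDirac.optimalFreeEnergy T H Q q ∧
      FermiDirac.optimalFreeEnergy T H Q q ≥ FermiDirac.optimalEnergy H Q q - ε := by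
  have h1 : FermiDirac.optimalFreeEnergy T H Q q ≥ FermiDirac.optimalEnergy H Q q
      - T * (d₀ * Real.log 2 + ((d : ℝ) - d₀) * Real.exp (-(Δ / T))) := by
    have hA := FermiDirac.isHermitian_shifted hH hQ μ
    have e1 := FermiDirac.dualFreeObjective_le_optimalFreeEnergy hH hQ hfeas hT μ
    have e2 := FermiDirac.optimalEnergy_le_of_dualObjective_le hH hQ hfeas hμ
    have e3 := FermiDirac.dualObjective_sub_le_dualFreeObjective (q := q) hA hd₀ (hker μ hμ𝕄) hΔ hT
      (hgap μ hμ𝕄)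
    linarith
  refine ⟨h1, fun ε _ hd hTε hTΔ => ⟨FermiDirac.optimalFreeEnergy_le_optimalEnergy hfeas hT.le, ?_⟩⟩
  have h2 := FermiDirac.temperature_correction_le (d := d) (d₀ := d₀) (by exact_mod_cast hd)
    hT hΔ hTε hTΔ
  linarith
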